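/- Let $(X,\mathscr A)$ be a measurable space and $\mu$ a probability measure on it. Let $\mathcal M$ be the ring of all real-valued measurable functions on $X$; for $f\in\mathcal M$ put $Z(f)=\{x\in X: f(x)=0\}$, and let $\mathcal M_\delta$ be $\mathcal M$ with the topology of the pseudometric $\delta(f,g)=\mu(X\setminus Z(f-g))$. An atom of a measure $\nu$ on $\mathscr A$ is a set $A\in\mathscr A$ with $\nu(A)>0$ such that for every $B\in\mathscr A$ either $\nu(A\cap B)=0$ or $\nu(A\setminus B)=0$; $\nu$ is purely atomic if every $E\in\mathscr A$ with $\nu(E)>0$ contains an atom, and non-atomic if it has no atoms. For measures $\nu,\nu'$ on $\mathscr A$ write $\nu\,\mathcal S\,\nu'$ if for every $E\in\mathscr A$ there is $F\in\mathscr A$, $F\subseteq E$, with $\nu(E)=\nu(F)$ and $\nu'(F)=0$. Suppose $\mu=\mu_1+\mu_2$, where $\mu_1$ is a purely atomic measure, $\mu_2$ is a non-atomic measure, $\mu_1\,\mathcal S\,\mu_2$ and $\mu_2\,\mathcal S\,\mu_1$. Let $K_0=\{f\in\mathcal M:\mu_1(X\setminus Z(f))=0\}$ and, for $f\in\mathcal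 M$, $K_f=f+K_0$. Then: 1. $K_0$ is a path connected subset of $\mathcal M_\delta$. 2. For every $\epsilon\in[0,1]\setminus\mu_1(\mathscr A)$, where $\mu_1(\mathscr A)=\{\mu_1(A):A\in\mathscr A\}$, the set $B_1(\epsilon)=\{f\in\mathcal M:\mu_1(X\setminus Z(f))<\epsilon\}$ is clopen in $\mathcal M_\delta$. 3. $K_0$ is the connected component of $0$ in $\mathcal M_\delta$. 4. For every $f\in\mathcal M$, $K_f=\{g\in\mathcal M:\mu_1(X\setminus Z(f-g))=0\}$, and $K_f$ is the connected component of $f$ in $\mathcal M_\delta$. 5. $K_0$ is the path component of $0$, and for every $f\in\mathcal M$ the set $K_f$ is the path component of $f$, in $\mathcal M_\delta$. -/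

import Mathlib

open MeasureTheory

/-- A measurable set `A` is an atom of `μ` if `μ A > 0` and every measurable `B` satisfies
`μ (A ∩ B) = 0` or `μ (A \ B) = 0`. (Mathlib's `NullSingletonClass` only speaks of singletons.) -/
def IsMeasureAtom {X : Type*} [MeasurableSpace X] (μ : Measure X) (A : Set X) : Prop :=
  MeasurableSet A ∧ 0 < μ A ∧ ∀ B : Set X, MeasurableSet B → μ (A ∩ B) = 0 ∨ μ (A \ B) = 0

/-- Every measurable set of positive measure contains an atom. -/
def PurelyAtomic {X : Type*} [MeasurableSpace X] (μ : Measure X) : Prop :=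
  ∀ E : Set X, MeasurableSet E → 0 < μ E → ∃ A : Set X, A ⊆ E ∧ IsMeasureAtom μ A

/-- There are no atoms. -/
def NonAtomic {X : Type*} [MeasurableSpace X] (μ : Measure X) : Prop :=
  ∀ A : Set X, ¬ IsMeasureAtom μ A

/-- `μ₁` is `𝒮`-singular with respect to `μ₂`. -/
def SSingular {X : Type*} [MeasurableSpace X] (μ₁ μ₂ : Measure X) : Prop :=
  ∀ E : Set X, MeasurableSet E →
    ∃ F : Set X, MeasurableSet F ∧ F ⊆ E ∧ μ₁ E = μ₁ F ∧ μ₂ F = 0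

/-- The ring of real-valued measurable functions on `X`, as a subring of all functions. -/
def measurableFunctionRing (X : Type*) [MeasurableSpace X] : Subring (X → ℝ) where
  carrier := {f | Measurable f}
  mul_mem' hf hg := Measurable.mul hf hg
  one_mem' := measurable_const
  add_mem' hf hg := Measurable.add hf hg
  zero_mem' := measurable_const
  neg_mem' hf := Measurable.neg hf

/-- The ring of measurable functions, to be equipped with the pseudometric coming from `μ`. -/
def MDelta {X : Type*} [MeasurableSpace X] (_μ : Measure X) : Type _ :=
  measurableFunctionRing X

namespace MDelta

variable {X : Type*} [MeasurableSpace X] {μ : Measure X}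

instance : CommRing (MDelta μ) := inferInstanceAs (CommRing (measurableFunctionRing X))

instance : CoeFun (MDelta μ) (fun _ => X → ℝ) := ⟨fun f => f.1⟩

/-- The zero set `Z(f)`. -/
def zeroSet (f : MDelta μ) : Set X := {x | f x = 0}

/-- The pseudo-rank function `N(f) = μ(X \ Z(f))`. -/
noncomputable def rank (f : MDelta μ) : ℝ := μ.real (zeroSet f)ᶜ

theorem compl_zeroSet_sub (f g : MDelta μ) : (zeroSet (f - g))ᶜ = {x | f x ≠ g x} := by
  ext x
  change ¬ (f x - g x = 0) ↔ f x ≠ g x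
  rw [sub_eq_zero]

/-- The pseudometric `δ(f, g) = μ(X \ Z(f - g))`; it induces the topology of `MDelta μ`. -/
noncomputable instance [IsProbabilityMeasure μ] : PseudoMetricSpace (MDelta μ) where
  dist f g := rank (f - g)
  dist_self f := by
    simp only [rank, compl_zeroSet_sub]
    simp
  dist_comm f g := by simp only [rank, compl_zeroSet_sub, ne_comm]
  dist_triangle f g h := by
    simp only [rank, compl_zeroSet_sub]
    refine le_trans (measureReal_mono ?_) (measureReal_union_le _ _)
    intro x hx
    by_contra hc
    simp only [Set.mem_union, Set.mem_ofPred_eq, not_or, not_not] at hc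
    exact hx (hc.1.trans hc.2)

/-- `K₀ = {f : μ₁(X \ Z(f)) = 0}`. -/
def K₀ (μ μ₁ : Measure X) : Set (MDelta μ) := {f | μ₁ (zeroSet f)ᶜ = 0}

/-- The translate `K_f = f + K₀`. -/
def K (μ μ₁ : Measure X) (f : MDelta μ) : Set (MDelta μ) := (fun h => f + h) '' K₀ μ μ₁

/-- `B₁(ε) = {f : μ₁(X \ Z(f)) < ε}`. -/
def B₁ (μ μ₁ : Measure X) (ε : ℝ) : Set (MDelta μ) := {f | μ₁.real (zeroSet f)ᶜ < ε}

end MDelta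

/-!
Write `E Δ F` for the symmetric difference and give the measurable sets the pseudometric
`(E, F) ↦ ν (E Δ F)`, which is complete. A maximal chain of measurable sets for almost everywhere
inclusion is closed, and `ν` is isometric on it, so the values of `ν` on the chain form a closed
set. If `ν` has no atoms, these values have no gaps either: across a gap, the difference `B \ A`
could be cut to produce a new member of the chain. Hence `ν` maps the chain isometrically onto
`[0, ν X]`, and the chain carries a path from `∅` to `X`.

If `f = g` almost everywhere for `μ₁`, then gluing `g` on `E` to `f` off `E` depends continuously on
`E` in the pseudometric of `μ₂`, so such a path for the non-atomic `μ₂` joins `f` to `g`. If on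
the other hand `f` and `g` differ on a set of positive `μ₁`-measure, they differ on some atom `A`,
and `μ₁ (A ∩ {f ≠ ·})` only takes the values `0` and `μ₁ A`, so its sublevel set at `μ₁ A / 2` is
a clopen set separating `g` from `f`.
-/

open Filter Set Topology
open scoped ENNReal symmDiff

section Order

theorem mem_of_isMaxChain {α : Type*} {r : α → α → Prop} {C : Set α} (hC : IsMaxChain r C) {a : α}
    (ha : ∀ b ∈ C, r a b ∨ r b a) : a ∈ C := by
  rw [hC.2 (hC.isChain.insert fun b hb _ => ha b hb) (subset_insert a C)]
  exact mem_insert a C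

theorem Icc_subset_of_isClosed_of_exists_between {α : Type*} [ConditionallyCompleteLinearOrder α]
    [TopologicalSpace α] [OrderTopology α] {s : Set α} (hs : IsClosed s) {a b : α} (ha : a ∈ s)
    (hb : b ∈ s) (hdense : ∀ x ∈ s, ∀ y ∈ s, x < y → ∃ z ∈ s, x < z ∧ z < y) : Icc a b ⊆ s := by
  rintro c ⟨hac, hcb⟩
  obtain ⟨x, ⟨hxs, -, hxc⟩, hx⟩ :=
    (isCompact_Icc.inter_left hs).exists_isGreatest ⟨a, ha, le_rfl, hac⟩
  obtain ⟨y, ⟨hys, hcy, -⟩, hy⟩ :=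
    (isCompact_Icc.inter_left hs).exists_isLeast ⟨b, hb, hcb, le_rfl⟩
  rcases (hxc.trans hcy).eq_or_lt with rfl | hxy
  · rwa [← hxc.antisymm hcy]
  obtain ⟨z, hzs, hxz, hzy⟩ := hdense x hxs y hys hxy
  rcases le_total z c with hzc | hcz
  · exact absurd (hx ⟨hzs, (hx ⟨ha, le_rfl, hac⟩).trans hxz.le, hzc⟩) hxz.not_ge
  · exact absurd (hy ⟨hzs, hcz, hzy.le.trans (hy ⟨hb, hcb, le_rfl⟩)⟩) hzy.not_ge

end Order

section MeasuredSets

variable {X : Type*} [MeasurableSpace X] {ν : Measure X}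

theorem symmDiff_liminf_subset {α : Type*} (D : ℕ → Set α) (n : ℕ) :
    D n ∆ liminf D atTop ⊆ ⋃ k, D (n + k) ∆ D (n + k + 1) := by
  intro x hx
  by_contra hstable
  have hstep : ∀ k, x ∈ D (n + k) ↔ x ∈ D (n + k + 1) := by
    simpa [mem_symmDiff, not_or, iff_iff_implies_and_implies] using hstable
  have hconst : ∀ k, x ∈ D (n + k) ↔ x ∈ D n := fun k => by
    induction k with
    | zero => rfl
    | succ k ih => exact (hstep k).symm.trans ih
  have hlim : x ∈ liminf D atTop ↔ x ∈ D n := by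
    rw [mem_liminf_iff_eventually_mem]
    refine ⟨fun h => ?_, fun h => ?_⟩
    · obtain ⟨m, hm⟩ := eventually_atTop.1 h
      exact (hconst m).1 (hm _ (Nat.le_add_left m n))
    · filter_upwards [eventually_ge_atTop n] with m hm
      obtain ⟨k, rfl⟩ := Nat.exists_eq_add_of_le hm
      exact (hconst k).2 h
  rw [mem_symmDiff] at hx
  tauto

instance : CompleteSpace (MeasuredSets ν) := by
  have hpos : ∀ n : ℕ, (0 : ℝ≥0∞) < 2⁻¹ ^ n := fun n => ENNReal.pow_pos (by simp) n
  refine EMetric.complete_of_convergent_controlled_sequences _ hpos fun D hD => ?_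
  let L : MeasuredSets ν :=
    ⟨liminf (fun n => (D n : Set X)) atTop, .measurableSet_liminf fun n => (D n).2⟩
  have hbound : ∀ n, edist (D n) L ≤ ∑' k, 2⁻¹ ^ (k + n) := fun n => calc
    edist (D n) L ≤ ν (⋃ k, (D (n + k) : Set X) ∆ D (n + k + 1)) :=
      measure_mono (symmDiff_liminf_subset (fun n => (D n : Set X)) n)
    _ ≤ ∑' k, edist (D (n + k)) (D (n + k + 1)) := measure_iUnion_le _
    _ ≤ ∑' k, 2⁻¹ ^ (k + n) := ENNReal.tsum_le_tsum fun k => by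
      rw [add_comm k]
      exact (hD _ _ _ le_rfl (Nat.le_succ _)).le
  have hsum : ∑' k : ℕ, (2⁻¹ : ℝ≥0∞) ^ k ≠ ∞ := by simp [ENNReal.tsum_geometric]
  exact ⟨L, tendsto_iff_edist_tendsto_0.2 <| tendsto_of_tendsto_of_tendsto_of_le_of_le
    tendsto_const_nhds (ENNReal.tendsto_sum_nat_add _ hsum) (fun _ => zero_le) hbound⟩

theorem measurableSet_coe (A : MeasuredSets ν) : MeasurableSet (A : Set X) := A.2

/-- Inclusion up to a null set, the preorder underlying the measure algebra of `ν`. It is a plain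
relation, not an order instance on `MeasuredSets ν`, since it is not the inclusion order there. -/
def AESubset (A B : MeasuredSets ν) : Prop := (A : Set X) ≤ᵐ[ν] (B : Set X)

namespace AESubset

theorem refl (A : MeasuredSets ν) : AESubset A A := Subset.rfl.eventuallyLE

theorem isClosed_setOf_left (B : MeasuredSets ν) :
    IsClosed {A : MeasuredSets ν | AESubset A B} := by
  have hcont : Continuous fun A : MeasuredSets ν => ν ((A : Set X) \ B) :=
    continuous_of_le_add_edist 1 ENNReal.one_ne_top fun A A' => by
      rw [one_mul, MeasuredSets.edist_def]
      exact (measure_mono (by grind)).trans (measure_union_le _ _)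
  simpa only [AESubset, ae_le_set] using isClosed_eq hcont continuous_const

theorem isClosed_setOf_right (B : MeasuredSets ν) :
    IsClosed {A : MeasuredSets ν | AESubset B A} := by
  have hcont : Continuous fun A : MeasuredSets ν => ν ((B : Set X) \ A) :=
    continuous_of_le_add_edist 1 ENNReal.one_ne_top fun A A' => by
      rw [one_mul, MeasuredSets.edist_def]
      exact (measure_mono (by grind)).trans (measure_union_le _ _)
  simpa only [AESubset, ae_le_set] using isClosed_eq hcont continuous_const

variable {C : Set (MeasuredSets ν)} {A B : MeasuredSets ν}

theorem isClosed_of_isMaxChain (hC : IsMaxChain AESubset C) : IsClosed C := by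
  refine isClosed_of_closure_subset fun A hA => mem_of_isMaxChain hC fun B hB => ?_
  refine closure_minimal (fun D hD => ?_)
    ((isClosed_setOf_left B).union (isClosed_setOf_right B)) hA
  rcases eq_or_ne D B with rfl | hne
  · exact Or.inl (refl D)
  · exact hC.isChain hD hB hne

theorem empty_mem_of_isMaxChain (hC : IsMaxChain AESubset C) :
    (⟨∅, .empty⟩ : MeasuredSets ν) ∈ C :=
  mem_of_isMaxChain hC fun B _ => Or.inl (empty_subset (B : Set X)).eventuallyLE

theorem univ_mem_of_isMaxChain (hC : IsMaxChain AESubset C) :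
    (⟨univ, .univ⟩ : MeasuredSets ν) ∈ C :=
  mem_of_isMaxChain hC fun B _ => Or.inr (subset_univ (B : Set X)).eventuallyLE

variable [IsFiniteMeasure ν]

theorem measureReal_sdiff (h : AESubset A B) :
    ν.real ((B : Set X) \ A) = ν.real B - ν.real A := by
  rw [measureReal_sdiff' (measurableSet_coe A),
    measureReal_congr (union_ae_eq_left_iff_ae_subset.2 h)]

theorem dist_eq (h : AESubset A B) : dist A B = ν.real B - ν.real A := by
  rw [MeasuredSets.dist_def, measureReal_symmDiff_eq (measurableSet_coe A) (measurableSet_coe B),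
    h.measureReal_sdiff, Measure.real, ae_le_set.1 h, ENNReal.toReal_zero, zero_add]

theorem of_measureReal_le (hC : IsChain AESubset C) (hA : A ∈ C) (hB : B ∈ C)
    (hle : ν.real A ≤ ν.real B) : AESubset A B := by
  rcases eq_or_ne A B with rfl | hne
  · exact refl A
  rcases hC hA hB hne with h | h
  · exact h
  · exact (ae_eq_of_ae_subset_of_measure_ge h
      ((ENNReal.toReal_le_toReal (measure_ne_top ν _) (measure_ne_top ν _)).1 hle)
      (measurableSet_coe B).nullMeasurableSet (measure_ne_top ν _)).symm.le

theorem isometry_measureReal (hC : IsChain AESubset C) :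
    Isometry fun A : C => ν.real (A : MeasuredSets ν) := by
  refine Isometry.of_dist_eq fun A B => ?_
  wlog hle : ν.real (A : MeasuredSets ν) ≤ ν.real (B : MeasuredSets ν) generalizing A B
  · rw [dist_comm, this B A (le_of_not_ge hle), dist_comm]
  rw [Subtype.dist_eq, (of_measureReal_le hC A.2 B.2 hle).dist_eq, Real.dist_eq, abs_sub_comm,
    abs_of_nonneg (sub_nonneg.2 hle)]

theorem isClosed_range_measureReal (hC : IsMaxChain AESubset C) :
    IsClosed (range fun A : C => ν.real (A : MeasuredSets ν)) := by
  have : CompleteSpace C := (isClosed_of_isMaxChain hC).completeSpace_coe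
  exact (isometry_measureReal hC.isChain).isUniformInducing.isComplete_range.isClosed

end AESubset

end MeasuredSets

section Atoms

variable {X : Type*} [MeasurableSpace X] {ν : Measure X} [IsFiniteMeasure ν]

theorem IsMeasureAtom.measureReal_restrict_ne_half {A : Set X} (hA : IsMeasureAtom ν A) (B : Set X)
    (hB : MeasurableSet B) : (ν.restrict A).real B ≠ ν.real A / 2 := by
  have hpos : 0 < ν.real A := ENNReal.toReal_pos hA.2.1.ne' (measure_ne_top ν A)
  have hadd := measureReal_inter_add_sdiff (μ := ν) (s := A) hB
  rw [measureReal_restrict_apply hB, inter_comm]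
  rcases hA.2.2 B hB with hnull | hnull <;>
    simp only [Measure.real, hnull, ENNReal.toReal_zero] at * <;> linarith

theorem NonAtomic.exists_subset_measureReal_lt (hν : NonAtomic ν) {E : Set X}
    (hE : MeasurableSet E) (hpos : 0 < ν.real E) :
    ∃ D ⊆ E, MeasurableSet D ∧ 0 < ν.real D ∧ ν.real D < ν.real E := by
  have hnot := hν E
  simp only [IsMeasureAtom, hE, (ENNReal.toReal_pos_iff.1 hpos).1, true_and, not_forall,
    not_or] at hnot
  obtain ⟨B, hB, hinter, hdiff⟩ := hnot
  have hinter_pos : 0 < ν.real (E ∩ B) := ENNReal.toReal_pos hinter (measure_ne_top ν _)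
  have hdiff_pos : 0 < ν.real (E \ B) := ENNReal.toReal_pos hdiff (measure_ne_top ν _)
  refine ⟨E ∩ B, inter_subset_left, hE.inter hB, hinter_pos, ?_⟩
  linarith [measureReal_inter_add_sdiff (μ := ν) (s := E) hB]

theorem NonAtomic.exists_between_of_isMaxChain (hν : NonAtomic ν) {C : Set (MeasuredSets ν)}
    (hC : IsMaxChain AESubset C) {A B : MeasuredSets ν} (hA : A ∈ C) (hB : B ∈ C)
    (hlt : ν.real A < ν.real B) : ∃ D ∈ C, ν.real A < ν.real D ∧ ν.real D < ν.real B := by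
  have hAB : AESubset A B := .of_measureReal_le hC.isChain hA hB hlt.le
  have hsdiff := hAB.measureReal_sdiff
  obtain ⟨D, hDsub, hD, hDpos, hDlt⟩ :=
    hν.exists_subset_measureReal_lt ((measurableSet_coe B).diff (measurableSet_coe A))
      (hsdiff ▸ sub_pos.2 hlt)
  let U : MeasuredSets ν := ⟨A ∪ D, A.2.union hD⟩
  have hU : ν.real U = ν.real A + ν.real D :=
    measureReal_union (disjoint_sdiff_right.mono_right hDsub) hD
  by_contra! hgap
  have hAU : AESubset A U := subset_union_left.eventuallyLE
  have hUB : AESubset U B :=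
    (EventuallyLE.union hAB (hDsub.trans sdiff_subset).eventuallyLE).trans
      (union_self _).subset.eventuallyLE
  have hUC : U ∈ C := mem_of_isMaxChain hC fun E hE => by
    rcases le_or_gt (ν.real E) (ν.real A) with hEA | hAE
    · exact Or.inr ((AESubset.of_measureReal_le hC.isChain hE hA hEA).trans hAU)
    · exact Or.inl (hUB.trans (AESubset.of_measureReal_le hC.isChain hB hE (hgap E hE hAE)))
  linarith [hgap U hUC (by linarith)]

theorem NonAtomic.isPathConnected_of_isMaxChain (hν : NonAtomic ν) {C : Set (MeasuredSets ν)}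
    (hC : IsMaxChain AESubset C) : IsPathConnected C := by
  have hrange : range (fun A : C => ν.real (A : MeasuredSets ν)) = Icc 0 (ν.real univ) := by
    refine Subset.antisymm ?_ (Icc_subset_of_isClosed_of_exists_between
      (AESubset.isClosed_range_measureReal hC)
      ⟨⟨_, AESubset.empty_mem_of_isMaxChain hC⟩, measureReal_empty⟩
      ⟨⟨_, AESubset.univ_mem_of_isMaxChain hC⟩, rfl⟩ ?_)
    · rintro _ ⟨A, rfl⟩
      exact ⟨measureReal_nonneg, measureReal_mono (subset_univ _)⟩
    · rintro _ ⟨A, rfl⟩ _ ⟨B, rfl⟩ hlt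
      obtain ⟨D, hD, hAD, hDB⟩ := hν.exists_between_of_isMaxChain hC A.2 B.2 hlt
      exact ⟨_, ⟨⟨D, hD⟩, rfl⟩, hAD, hDB⟩
  rw [isPathConnected_iff_pathConnectedSpace, pathConnectedSpace_iff_univ,
    (AESubset.isometry_measureReal hC.isChain).isUniformInducing.isInducing.isPathConnected_iff,
    image_univ, hrange]
  exact (convex_Icc _ _).isPathConnected (nonempty_Icc.2 measureReal_nonneg)

theorem NonAtomic.joined_empty_univ (hν : NonAtomic ν) :
    Joined (X := MeasuredSets ν) ⟨∅, .empty⟩ ⟨univ, .univ⟩ := by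
  obtain ⟨C, hC, -⟩ := (IsChain.empty (r := AESubset (ν := ν))).exists_maxChain
  exact ((hν.isPathConnected_of_isMaxChain hC).joinedIn _ (AESubset.empty_mem_of_isMaxChain hC)
    _ (AESubset.univ_mem_of_isMaxChain hC)).joined

end Atoms

namespace MDelta

variable {X : Type*} [MeasurableSpace X] {μ ν : Measure X}

theorem measurableSet_ne (f g : MDelta μ) : MeasurableSet {x | f x ≠ g x} :=
  (measurableSet_eq_fun f.2 g.2).compl

theorem compl_zeroSet (f : MDelta μ) : (zeroSet f)ᶜ = {x | (0 : MDelta μ) x ≠ f x} := by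
  ext x
  exact ne_comm

theorem mem_K_iff {f g : MDelta μ} : g ∈ K μ ν f ↔ ν {x | f x ≠ g x} = 0 := by
  have hsub : g - f ∈ K₀ μ ν ↔ ν {x | f x ≠ g x} = 0 := by
    simp only [K₀, mem_ofPred_eq, compl_zeroSet_sub, ne_comm]
  rw [← hsub]
  refine ⟨?_, fun h => ⟨g - f, h, add_sub_cancel f g⟩⟩
  rintro ⟨h, hh, rfl⟩
  simpa using hh

theorem self_mem_K (f : MDelta μ) : f ∈ K μ ν f := by
  simp [mem_K_iff]

theorem K_zero : K μ ν 0 = K₀ μ ν := by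
  simp [K]

section Topology

variable [IsProbabilityMeasure μ]

theorem edist_eq (f g : MDelta μ) : edist f g = μ {x | f x ≠ g x} := by
  rw [edist_dist, ← compl_zeroSet_sub]
  exact ofReal_measureReal

theorem continuous_measureReal_ne (hν : ν ≤ μ) (f : MDelta μ) :
    Continuous fun g : MDelta μ => ν.real {x | f x ≠ g x} := by
  have : IsFiniteMeasure ν := isFiniteMeasure_of_le μ hν
  have hcont : Continuous fun g : MDelta μ => ν {x | f x ≠ g x} :=
    continuous_of_le_add_edist 1 ENNReal.one_ne_top fun g h => calc
      ν {x | f x ≠ g x} ≤ ν ({x | f x ≠ h x} ∪ {x | g x ≠ h x}) := measure_mono fun x hx => by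
        by_contra hxu
        simp_all
      _ ≤ ν {x | f x ≠ h x} + ν {x | g x ≠ h x} := measure_union_le _ _
      _ ≤ ν {x | f x ≠ h x} + 1 * edist g h := by
        rw [one_mul, edist_eq]
        gcongr
  exact continuous_iff_continuousAt.2 fun g =>
    (ENNReal.tendsto_toReal (measure_ne_top ν _)).comp hcont.continuousAt

theorem isClopen_setOf_measureReal_ne_lt (hν : ν ≤ μ) {ε : ℝ}
    (hε : ∀ A, MeasurableSet A → ν.real A ≠ ε) (f : MDelta μ) :
    IsClopen {g : MDelta μ | ν.real {x | f x ≠ g x} < ε} := by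
  have hcont := continuous_measureReal_ne hν f
  refine ⟨?_, isOpen_lt hcont continuous_const⟩
  simp only [← (hε _ (measurableSet_ne f _)).le_iff_lt]
  exact isClosed_le hcont continuous_const

theorem isClopen_B₁ (hν : ν ≤ μ) {ε : ℝ} (hε : ∀ A, MeasurableSet A → ν.real A ≠ ε) :
    IsClopen (B₁ μ ν ε) := by
  simpa only [B₁, compl_zeroSet] using isClopen_setOf_measureReal_ne_lt hν hε 0

theorem connectedComponent_subset_K (hν : ν ≤ μ) (hatom : PurelyAtomic ν) (f : MDelta μ) :
    connectedComponent f ⊆ K μ ν f := by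
  have : IsFiniteMeasure ν := isFiniteMeasure_of_le μ hν
  intro g hg
  rw [mem_K_iff]
  by_contra hne
  obtain ⟨A, hAsub, hA⟩ := hatom _ (measurableSet_ne f g) (pos_iff_ne_zero.2 hne)
  have hpos : 0 < ν.real A := ENNReal.toReal_pos hA.2.1.ne' (measure_ne_top ν A)
  have hclopen := isClopen_setOf_measureReal_ne_lt (Measure.restrict_le_self.trans hν)
    hA.measureReal_restrict_ne_half f
  have hlt : (ν.restrict A).real {x | f x ≠ g x} < ν.real A / 2 :=
    hclopen.connectedComponent_subset (x := f) (by simpa using hpos) hg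
  rw [measureReal_restrict_apply (measurableSet_ne f g), inter_eq_right.2 hAsub] at hlt
  linarith

end Topology

section Gluing

variable {μ₁ μ₂ : Measure X} {f g : MDelta μ}

open scoped Classical in
/-- The measurable function which equals `g` on `E` and `f` off `E`. The set `E` is taken in
`MeasuredSets ν` to make continuity in `E` meaningful. -/
noncomputable def glue (f g : MDelta μ) (E : MeasuredSets ν) : MDelta μ :=
  ⟨(E : Set X).piecewise g f, Measurable.piecewise E.2 g.2 f.2⟩

theorem glue_empty : glue (ν := ν) f g ⟨∅, .empty⟩ = f :=
  Subtype.ext (funext fun x => if_neg (notMem_empty x))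

theorem glue_univ : glue (ν := ν) f g ⟨univ, .univ⟩ = g :=
  Subtype.ext (funext fun x => if_pos (mem_univ x))

theorem glue_ne_glue_subset (D E : MeasuredSets ν) :
    {x | glue f g D x ≠ glue f g E x} ⊆ {x | f x ≠ g x} ∩ (D : Set X) ∆ E := by
  intro x
  by_cases hD : x ∈ D <;> by_cases hE : x ∈ E <;>
    simp [glue, piecewise, mem_symmDiff, hD, hE, eq_comm]

theorem glue_mem_K (hg : g ∈ K μ μ₁ f) (E : MeasuredSets ν) : glue f g E ∈ K μ μ₁ f := by
  rw [mem_K_iff] at hg ⊢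
  nth_rw 1 [← glue_empty (ν := ν) (f := f) (g := g)]
  exact measure_mono_null ((glue_ne_glue_subset _ E).trans inter_subset_left) hg

variable [IsProbabilityMeasure μ]

theorem continuous_glue (hμ : μ = μ₁ + μ₂) (hg : g ∈ K μ μ₁ f) :
    Continuous (glue f g : MeasuredSets μ₂ → MDelta μ) := by
  refine LipschitzWith.continuous (K := 1) fun D E => ?_
  have hsub := glue_ne_glue_subset (f := f) (g := g) D E
  calc edist (glue f g D) (glue f g E)
      = μ₁ {x | glue f g D x ≠ glue f g E x} + μ₂ {x | glue f g D x ≠ glue f g E x} := by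
        rw [edist_eq, ← Measure.add_apply, ← hμ]
    _ ≤ 0 + edist D E := add_le_add
        (measure_mono_null (hsub.trans inter_subset_left) (mem_K_iff.1 hg)).le
        (measure_mono (hsub.trans inter_subset_right))
    _ = (1 : NNReal) * edist D E := by simp

theorem joinedIn_K (hμ : μ = μ₁ + μ₂) (h₂ : NonAtomic μ₂) (hg : g ∈ K μ μ₁ f) :
    JoinedIn (K μ μ₁ f) f g := by
  have : IsFiniteMeasure μ₂ := isFiniteMeasure_of_le μ (hμ ▸ Measure.le_add_left le_rfl)
  have hjoined := (joinedIn_univ.2 h₂.joined_empty_univ).map (continuous_glue hμ hg)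
  rw [glue_empty, glue_univ] at hjoined
  exact hjoined.mono (image_subset_iff.2 fun E _ => glue_mem_K hg E)

theorem isPathConnected_K (hμ : μ = μ₁ + μ₂) (h₂ : NonAtomic μ₂) (f : MDelta μ) :
    IsPathConnected (K μ μ₁ f) :=
  ⟨f, self_mem_K f, fun _ hg => joinedIn_K hμ h₂ hg⟩

theorem connectedComponent_eq_K (hμ : μ = μ₁ + μ₂) (h₁ : PurelyAtomic μ₁) (h₂ : NonAtomic μ₂)
    (f : MDelta μ) : connectedComponent f = K μ μ₁ f :=
  (connectedComponent_subset_K (hμ ▸ Measure.le_add_right le_rfl) h₁ f).antisymm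
    ((isPathConnected_K hμ h₂ f).isConnected.isPreconnected.subset_connectedComponent
      (self_mem_K f))

theorem pathComponent_eq_K (hμ : μ = μ₁ + μ₂) (h₁ : PurelyAtomic μ₁) (h₂ : NonAtomic μ₂)
    (f : MDelta μ) : pathComponent f = K μ μ₁ f :=
  ((pathComponent_subset_component f).trans (connectedComponent_eq_K hμ h₁ h₂ f).subset).antisymm
    ((isPathConnected_K hμ h₂ f).subset_pathComponent (self_mem_K f))

end Gluing

end MDelta

theorem theorem3p8 {X : Type*} [MeasurableSpace X]
    (μ μ₁ μ₂ : MeasureTheory.Measure X) [MeasureTheory.IsProbabilityMeasure μ]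
    (hμ : μ = μ₁ + μ₂) (h₁ : PurelyAtomic μ₁) (h₂ : NonAtomic μ₂)
    (h₁₂ : SSingular μ₁ μ₂) (h₂₁ : SSingular μ₂ μ₁) :
    IsPathConnected (MDelta.K₀ μ μ₁) ∧
    (∀ ε ∈ Set.Icc (0 : ℝ) 1, ε ∉ {r : ℝ | ∃ A : Set X, MeasurableSet A ∧ μ₁.real A = r} →
      IsClopen (MDelta.B₁ μ μ₁ ε)) ∧
    connectedComponent (0 : MDelta μ) = MDelta.K₀ μ μ₁ ∧
    (∀ f : MDelta μ,
      MDelta.K μ μ₁ f = {g : MDelta μ | μ₁ (MDelta.zeroSet (f - g))ᶜ = 0} ∧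
      connectedComponent f = MDelta.K μ μ₁ f) ∧
    pathComponent (0 : MDelta μ) = MDelta.K₀ μ μ₁ ∧
    (∀ f : MDelta μ, pathComponent f = MDelta.K μ μ₁ f) := by
  rw [← MDelta.K_zero]
  refine ⟨MDelta.isPathConnected_K hμ h₂ 0, fun ε _ hε => ?_,
    MDelta.connectedComponent_eq_K hμ h₁ h₂ 0,
    fun f => ⟨?_, MDelta.connectedComponent_eq_K hμ h₁ h₂ f⟩,
    MDelta.pathComponent_eq_K hμ h₁ h₂ 0, MDelta.pathComponent_eq_K hμ h₁ h₂⟩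
  · exact MDelta.isClopen_B₁ (hμ ▸ Measure.le_add_right le_rfl) fun A hA h => hε ⟨A, hA, h⟩
  · ext g
    rw [MDelta.mem_K_iff, Set.mem_ofPred_eq, MDelta.compl_zeroSet_sub]
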